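/- Let $(a_k)_{k\in\mathbb Z}$ be complex numbers with $|a_k|\le c\,e^{-\gamma|k|}$ for all $k\in\mathbb Z$, where $c$ and $\gamma>0$ are constants, and suppose that the infinite Toeplitz matrix $A=[a_{k-l}]$, biinfinite ($k,l\in\mathbb Z$) or singly infinite ($k,l\in\mathbb N=\{0,1,2,\dots\}$), is hermitian positive definite, i.e. it defines a positive self-adjoint operator with bounded inverse on $\ell^2(\mathbb Z)$, respectively $\ell^2(\mathbb N)$. For $n\ge 1$ let $A_n=[a_{k-l}]_{k,l=0}^{n-1}$, and let $B_n$ be the $n\times n$ Toeplitz matrix with entries $$(B_n)_{kl}=\begin{cases}a_{n+k-l}, & k<l,\\ b_0, & k=l,\\ a_{k-l-n}, & k>l,\end{cases}$$ where either $b_0=a_n$ or $b_0=0$; thus $A_n$ is embedded in the $2n\times 2n$ matrix $C_{2n}=\begin{bmatrix}A_n & B_n^*\\ B_n & A_n\end{bmatrix}$, which is circulant when $b_0$ is real. Put $S_n=A_n-B_nA_n^{-1}B_n^*$. Then for every $\varepsilon>0$ there exist $N$ and $M>0$ such that for all $n>M$ (and either choice of $b_0$) the matrices $A_n$ and $S_n$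 are invertible and at most $N$ eigenvalues of $S_n^{-1}A_n-I_n$, counted with algebraic multiplicity, have absolute value larger than $\varepsilon$. Equivalently, the spectrum of $S_n^{-1}A_n$ is clustered around $1$: for all $n>M$ at most $N$ eigenvalues $\lambda$ of $S_n^{-1}A_n$, counted with algebraic multiplicity, satisfy $|\lambda-1|>\varepsilon$. -/

import Mathlib

open scoped Matrix

noncomputable section

/-- The bounded operator `T` on `ℓ²(ι)` is given, in the standard basis, by the infinite Toeplitz
matrix with entries `a (k - l)`. The index set `ι` is `ℤ` (with `pos k = k`, a biinfinite Toeplitz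
matrix) or `ℕ` (with `pos k = (k : ℤ)`, a singly infinite Toeplitz matrix). -/
def IsToeplitzOperator {ι : Type} [DecidableEq ι] (pos : ι → ℤ) (a : ℤ → ℂ)
    (T : lp (fun _ : ι => ℂ) 2 →L[ℂ] lp (fun _ : ι => ℂ) 2) : Prop :=
  ∀ k l : ι, (T (lp.single 2 l (1 : ℂ))) k = a (pos k - pos l)

/-- The infinite Toeplitz matrix `[a (k - l)]` is hermitian positive definite: it defines a bounded,
positive (in particular self-adjoint) and boundedly invertible operator on `ℓ²(ι)`. -/
def IsHPDToeplitz {ι : Type} [DecidableEq ι] (pos : ι → ℤ) (a : ℤ → ℂ) : Prop :=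
  ∃ T : lp (fun _ : ι => ℂ) 2 →L[ℂ] lp (fun _ : ι => ℂ) 2,
    IsToeplitzOperator pos a T ∧ T.IsPositive ∧ IsUnit T

/-- The finite section `A_n`, with entries `a (k - l)` for `0 ≤ k, l < n`. -/
def toeplitzSection (a : ℤ → ℂ) (n : ℕ) : Matrix (Fin n) (Fin n) ℂ :=
  Matrix.of fun k l => a ((k : ℤ) - (l : ℤ))

/-- The Toeplitz block `B_n` of the embedding of `A_n` into the `2n × 2n` matrix
`C_{2n} = [A_n, B_n^*; B_n, A_n]`, which is circulant when `b₀` is real. Its first row is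
`(b₀, a (n-1), …, a 1)` and its first column is `(b₀, a (-(n-1)), …, a (-1))`. -/
def embeddingBlock (a : ℤ → ℂ) (n : ℕ) (b₀ : ℂ) : Matrix (Fin n) (Fin n) ℂ :=
  Matrix.of fun k l =>
    if k < l then a ((n : ℤ) + k - l) else if k = l then b₀ else a ((k : ℤ) - l - n)

/-- The preconditioner `S_n = A_n - B_n A_n⁻¹ B_n^*`, a Schur complement in `C_{2n}`. -/
def embeddingPreconditioner (a : ℤ → ℂ) (n : ℕ) (b₀ : ℂ) : Matrix (Fin n) (Fin n) ℂ :=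
  toeplitzSection a n -
    embeddingBlock a n b₀ * (toeplitzSection a n)⁻¹ * (embeddingBlock a n b₀)ᴴ

/-- The number of eigenvalues `z` of `X`, counted with algebraic multiplicity, such that
`|z - z₀| > ε`. -/
def numEigenvaluesOutside {n : ℕ} (X : Matrix (Fin n) (Fin n) ℂ) (z₀ : ℂ) (ε : ℝ) : ℕ :=
  X.charpoly.roots.countP fun z => ε < ‖z - z₀‖

end

/-! Since `S⁻¹ A - 1 = S⁻¹ (B A⁻¹ Bᴴ)` is a positive definite times a positive semidefinite matrix,
its eigenvalues are nonnegative. By Markov's inequality at most trace/ε of them exceed ε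
(`numEigenvaluesOutside_mul_le_trace`), so it suffices to bound the trace uniformly in n. If `A ≥ δ`
and `S ≥ δ/2`, the trace is at most `(2/δ) δ⁻¹ ‖B‖²` in the Frobenius norm. This norm is bounded
because the entries of `B` decay geometrically away from two opposite corners
(`sum_norm_sq_embeddingBlock_le`).

The bound on `A` is inherited from the infinite operator. The bound on `S` is the main point
(`embeddingPreconditioner_sub_posSemidef`): `S` is a Schur complement in the embedding matrix, which
for zero corner entry is the 2n-periodization of the coefficients of degree below n. Truncation
costs only a small tail (`norm_toeplitzForm_le`), and periodization preserves coercivity, as testing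
on many repeated copies of a vector shows (`le_periodized_toeplitzForm`). The corner entry is a
further small perturbation. -/

/-! ### Uniform coercivity inherited from the infinite operator. -/

theorem ContinuousLinearMap.IsPositive.exists_pos_forall_mul_norm_sq_le
    {H : Type*} [NormedAddCommGroup H] [InnerProductSpace ℂ H] [CompleteSpace H]
    {T : H →L[ℂ] H} (hT : T.IsPositive) (hu : IsUnit T) :
    ∃ δ : ℝ, 0 < δ ∧ ∀ x : H, δ * ‖x‖ ^ 2 ≤ (inner ℂ x (T x)).re := by
  rcases subsingleton_or_nontrivial H with hH | hH
  · exact ⟨1, one_pos, fun x => by simp [Subsingleton.elim x 0]⟩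
  have h0 : 0 ≤ T := (ContinuousLinearMap.nonneg_iff_isPositive T).2 hT
  have hs : ∀ x ∈ spectrum ℝ T, 0 < x := fun x hx =>
    (spectrum_nonneg_of_nonneg h0 hx).lt_of_ne fun h =>
      spectrum.zero_notMem ℝ hu (h ▸ hx)
  -- The spectrum is compact and contained in the positive reals, hence bounded away from zero.
  obtain ⟨r, hr, hle⟩ := (CFC.exists_pos_algebraMap_le_iff (a := T) hT.isSelfAdjoint).2 hs
  refine ⟨r, hr, fun x => ?_⟩
  have h1 := ((ContinuousLinearMap.le_def _ _).1 hle).re_inner_nonneg_right x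
  have h2 : (algebraMap ℝ (H →L[ℂ] H) r) x = (r : ℂ) • x := by
    simp [Algebra.algebraMap_eq_smul_one]
  rw [sub_apply, h2, inner_sub_right, inner_smul_right,
    inner_self_eq_norm_sq_to_K] at h1
  have h3 : ((r : ℂ) * ((‖x‖ : ℂ)) ^ 2).re = r * ‖x‖ ^ 2 := by
    rw [← Complex.ofReal_pow, ← Complex.ofReal_mul, Complex.ofReal_re]
  simp only [map_sub, RCLike.re_to_complex, Complex.coe_algebraMap] at h1
  linarith

/-- The sesquilinear form of the Toeplitz matrix `[a (pos i - pos j)]`. -/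
def toeplitzForm {ι : Type*} [Fintype ι] (pos : ι → ℤ) (a : ℤ → ℂ) (x : ι → ℂ) : ℂ :=
  ∑ i, ∑ j, star (x i) * a (pos i - pos j) * x j

theorem IsToeplitzOperator.apply_neg {κ : Type} [DecidableEq κ] {pos : κ → ℤ} {a : ℤ → ℂ}
    {T : lp (fun _ : κ => ℂ) 2 →L[ℂ] lp (fun _ : κ => ℂ) 2} (h : IsToeplitzOperator pos a T)
    (hT : T.IsPositive) (k l : κ) : a (pos l - pos k) = star (a (pos k - pos l)) := by
  have h1 := hT.inner_left_eq_inner_right (lp.single 2 k (1 : ℂ)) (lp.single 2 l (1 : ℂ))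
  rw [lp.inner_single_left, lp.inner_single_right, h, h] at h1
  simpa using congrArg star h1

theorem IsToeplitzOperator.inner_sum_single {κ : Type} [DecidableEq κ] {pos : κ → ℤ} {a : ℤ → ℂ}
    {T : lp (fun _ : κ => ℂ) 2 →L[ℂ] lp (fun _ : κ => ℂ) 2} (h : IsToeplitzOperator pos a T)
    {ι : Type*} [Fintype ι] (q : ι → κ) (x : ι → ℂ) :
    inner ℂ (∑ i, x i • lp.single 2 (q i) (1 : ℂ)) (T (∑ i, x i • lp.single 2 (q i) (1 : ℂ))) =
      toeplitzForm (fun i => pos (q i)) a x := by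
  rw [map_sum, sum_inner]
  refine Finset.sum_congr rfl fun i _ => ?_
  rw [inner_sum]
  refine Finset.sum_congr rfl fun j _ => ?_
  rw [map_smul, inner_smul_left, inner_smul_right, lp.inner_single_left, h]
  simp
  ring

theorem lp.norm_sq_sum_smul_single {κ : Type} [DecidableEq κ]
    {ι : Type*} [Fintype ι] [DecidableEq ι] {q : ι → κ} (hq : Function.Injective q) (x : ι → ℂ) :
    ‖∑ i, x i • (lp.single 2 (q i) (1 : ℂ) : lp (fun _ : κ => ℂ) 2)‖ ^ 2 = ∑ i, ‖x i‖ ^ 2 := by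
  have h : inner ℂ (∑ i, x i • (lp.single 2 (q i) (1 : ℂ) : lp (fun _ : κ => ℂ) 2))
      (∑ i, x i • (lp.single 2 (q i) (1 : ℂ) : lp (fun _ : κ => ℂ) 2)) =
      ((∑ i, ‖x i‖ ^ 2 : ℝ) : ℂ) := by
    rw [sum_inner, Complex.ofReal_sum]
    refine Finset.sum_congr rfl fun i _ => ?_
    rw [inner_sum, Finset.sum_eq_single i]
    · rw [inner_smul_left, inner_smul_right, lp.inner_single_left]
      simp [Complex.conj_mul']
    · intro j _ hj
      rw [inner_smul_left, inner_smul_right, lp.inner_single_left]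
      simp [lp.single_apply, Pi.single_eq_of_ne (fun h => hj (hq h).symm : q i ≠ q j)]
    · simp
  rw [inner_self_eq_norm_sq_to_K] at h
  exact Complex.ofReal_injective (by simpa using h)

/-- A hermitian positive definite infinite Toeplitz matrix has hermitian coefficients, and its
principal submatrices are uniformly coercive. -/
theorem IsHPDToeplitz.exists_coercive {a : ℤ → ℂ}
    (hpd : IsHPDToeplitz (fun k : ℤ => k) a ∨ IsHPDToeplitz (fun k : ℕ => (k : ℤ)) a) :
    (∀ k, a (-k) = star (a k)) ∧ ∃ δ : ℝ, 0 < δ ∧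
      ∀ (ι : Type) [Fintype ι] (q : ι → ℕ), Function.Injective q → ∀ x : ι → ℂ,
        δ * ∑ i, ‖x i‖ ^ 2 ≤ (toeplitzForm (fun i => (q i : ℤ)) a x).re := by
  classical
  rcases hpd with ⟨T, hT, hpos, hu⟩ | ⟨T, hT, hpos, hu⟩ <;>
    obtain ⟨δ, hδ, hle⟩ := hpos.exists_pos_forall_mul_norm_sq_le hu
  · refine ⟨fun k => by simpa using hT.apply_neg hpos k 0, δ, hδ, fun ι _ q hq x => ?_⟩
    have h := hle (∑ i, x i • lp.single 2 ((q i : ℕ) : ℤ) (1 : ℂ))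
    rwa [hT.inner_sum_single (fun i => (q i : ℤ)),
      lp.norm_sq_sum_smul_single (q := fun i => (q i : ℤ)) (Nat.cast_injective.comp hq)] at h
  · refine ⟨fun k => ?_, δ, hδ, fun ι _ q hq x => ?_⟩
    -- Positions in `ℕ` are nonnegative, so `a k` is read off the first column or the first row
    -- according to its sign.
    · rcases le_total 0 k with hk | hk
      · lift k to ℕ using hk
        simpa using hT.apply_neg hpos k 0
      · obtain ⟨m, rfl⟩ : ∃ m : ℕ, k = -m := ⟨k.natAbs, by omega⟩
        simpa using hT.apply_neg hpos 0 m
    have h := hle (∑ i, x i • lp.single 2 (q i) (1 : ℂ))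
    rwa [hT.inner_sum_single q, lp.norm_sq_sum_smul_single hq] at h

/-! ### Counting eigenvalues by traces. -/

open scoped ComplexOrder

/-- A matrix whose difference with `z₀` is `S⁻¹ E`, with `S` positive definite and `E` positive
semidefinite, has few eigenvalues away from `z₀` when `S⁻¹ E` has small trace. -/
theorem numEigenvaluesOutside_mul_le_trace {n : ℕ} {S E X : Matrix (Fin n) (Fin n) ℂ} {z₀ : ℂ}
    (hS : S.PosDef) (hE : E.PosSemidef) (hX : X - Matrix.scalar (Fin n) z₀ = S⁻¹ * E) (ε : ℝ) :
    numEigenvaluesOutside X z₀ ε * ε ≤ (S⁻¹ * E).trace.re := by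
  have hSu : IsUnit S.det := (Matrix.isUnit_iff_isUnit_det _).1 hS.isUnit
  have hroot : ∀ z ∈ X.charpoly.roots, 0 ≤ z - z₀ := by
    intro z hz
    have hz' : (Matrix.scalar (Fin n) z - X).det = 0 := by
      rw [← Matrix.eval_charpoly]
      exact (Polynomial.mem_roots'.1 hz).2
    obtain ⟨v, hv, hv0⟩ := Matrix.exists_mulVec_eq_zero_iff.2 hz'
    -- A generalized eigenvalue problem: `z - z₀` is the Rayleigh quotient of `E` against `S` at
    -- `v`, hence nonnegative.
    have h1 : E *ᵥ v = (z - z₀) • (S *ᵥ v) := by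
      have h2 : Matrix.scalar (Fin n) z - X = (z - z₀) • (1 : Matrix (Fin n) (Fin n) ℂ) - S⁻¹ * E := by
        rw [← hX, Matrix.scalar_apply, Matrix.scalar_apply, sub_smul, Matrix.smul_one_eq_diagonal,
          Matrix.smul_one_eq_diagonal]
        abel
      rw [h2, Matrix.sub_mulVec, sub_eq_zero, Matrix.smul_mulVec, Matrix.one_mulVec,
        ← Matrix.mulVec_mulVec] at hv0
      rw [← Matrix.mulVec_smul, hv0, Matrix.mulVec_mulVec, Matrix.mul_nonsing_inv _ hSu,
        Matrix.one_mulVec]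
    have h3 := hE.dotProduct_mulVec_nonneg v
    have h4 := hS.dotProduct_mulVec_pos hv
    rw [h1, dotProduct_smul, smul_eq_mul] at h3
    exact le_of_mul_le_mul_right (by simpa using h3) h4
  have hsum : (S⁻¹ * E).trace = (X.charpoly.roots.map fun z => z - z₀).sum := by
    have hcard : Multiset.card X.charpoly.roots = n := by
      rw [← (IsAlgClosed.splits X.charpoly).natDegree_eq_card_roots,
        Matrix.charpoly_natDegree_eq_dim, Fintype.card_fin]
    rw [← hX, Matrix.trace_sub, Matrix.trace_eq_sum_roots_charpoly, Multiset.sum_map_sub]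
    simp [hcard, Matrix.scalar_apply, Matrix.trace_diagonal]
  rw [hsum, numEigenvaluesOutside]
  clear hsum hX
  -- What remains is Markov's inequality for a multiset of nonnegative shifts `z - z₀`.
  generalize X.charpoly.roots = r at hroot ⊢
  induction r using Multiset.induction_on with
  | empty => simp
  | cons z s ih =>
    have hz := hroot z (Multiset.mem_cons_self z s)
    have ih' := ih fun w hw => hroot w (Multiset.mem_cons_of_mem hw)
    have hre := (Complex.le_def.1 hz).1
    have hnorm : ‖z - z₀‖ = (z - z₀).re := by
      simpa using congrArg Complex.re (Complex.norm_of_nonneg' hz)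
    rw [Multiset.countP_cons, Multiset.map_cons, Multiset.sum_cons, Complex.add_re]
    split_ifs with h
    · push_cast
      linarith
    · simp only [Complex.zero_re] at hre
      rw [add_zero]
      linarith

open scoped MatrixOrder Matrix.Norms.L2Operator in
theorem Matrix.PosSemidef.trace_mul_nonneg {n : Type*} [Fintype n] [DecidableEq n]
    {P E : Matrix n n ℂ} (hP : P.PosSemidef) (hE : E.PosSemidef) : 0 ≤ (P * E).trace := by
  obtain ⟨G, rfl⟩ : ∃ G : Matrix n n ℂ, E = Gᴴ * G :=
    CStarAlgebra.nonneg_iff_eq_star_mul_self.1 hE.nonneg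
  rw [← Matrix.mul_assoc, Matrix.trace_mul_comm, ← Matrix.mul_assoc]
  exact (hP.mul_mul_conjTranspose_same G).trace_nonneg

theorem Matrix.PosDef.of_sub_smul_one {n : Type*} [Fintype n] [DecidableEq n]
    {S : Matrix n n ℂ} {δ : ℝ} (hδ : 0 < δ) (h : (S - (δ : ℂ) • 1).PosSemidef) : S.PosDef := by
  have h1 : ((δ : ℂ) • (1 : Matrix n n ℂ)).PosDef :=
    Matrix.PosDef.one.smul (by exact_mod_cast hδ)
  simpa using h1.add_posSemidef h

/-- Both this and the hypothesis are Schur complements of the block matrix `[S, 1; 1, δ⁻¹]`, one for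
each diagonal block. -/
theorem Matrix.PosSemidef.inv_smul_one_sub_inv {n : Type*} [Fintype n] [DecidableEq n]
    {S : Matrix n n ℂ} {δ : ℝ} (hδ : 0 < δ) (h : (S - (δ : ℂ) • 1).PosSemidef) :
    ((δ : ℂ)⁻¹ • 1 - S⁻¹).PosSemidef := by
  have hS := Matrix.PosDef.of_sub_smul_one hδ h
  have hδ' : (δ : ℂ) ≠ 0 := by exact_mod_cast hδ.ne'
  have hD : ((δ : ℂ)⁻¹ • (1 : Matrix n n ℂ)).PosDef :=
    Matrix.PosDef.one.smul (by rw [← Complex.ofReal_inv]; exact_mod_cast inv_pos.2 hδ)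
  have hinv : ((δ : ℂ)⁻¹ • (1 : Matrix n n ℂ))⁻¹ = (δ : ℂ) • 1 :=
    Matrix.inv_eq_right_inv (by rw [Matrix.smul_mul, Matrix.one_mul, smul_smul, inv_mul_cancel₀ hδ', one_smul])
  have := hS.isUnit.invertible
  have := hD.isUnit.invertible
  have h2 := (Matrix.PosDef.fromBlocks₂₂ S (1 : Matrix n n ℂ) hD).2 (by simpa [hinv] using h)
  simpa using (Matrix.PosDef.fromBlocks₁₁ (1 : Matrix n n ℂ) _ hS).1 h2

theorem Matrix.PosSemidef.trace_inv_mul_le {n : Type*} [Fintype n] [DecidableEq n]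
    {S E : Matrix n n ℂ} {δ : ℝ} (hδ : 0 < δ) (h : (S - (δ : ℂ) • 1).PosSemidef)
    (hE : E.PosSemidef) : (S⁻¹ * E).trace.re ≤ δ⁻¹ * E.trace.re := by
  have h1 := (Matrix.PosSemidef.inv_smul_one_sub_inv hδ h).trace_mul_nonneg hE
  rw [Matrix.sub_mul, Matrix.trace_sub, Matrix.smul_mul, Matrix.one_mul, Matrix.trace_smul,
    smul_eq_mul, ← Complex.ofReal_inv] at h1
  have h2 := (Complex.le_def.1 h1).1
  simpa using h2

theorem Matrix.trace_mul_conjTranspose_self_re {m n : Type*} [Fintype m] [Fintype n]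
    (B : Matrix m n ℂ) : (B * Bᴴ).trace.re = ∑ k, ∑ l, ‖B k l‖ ^ 2 := by
  simp only [Matrix.trace, Matrix.diag_apply, Matrix.mul_apply, Matrix.conjTranspose_apply,
    Complex.re_sum]
  refine Finset.sum_congr rfl fun k _ => Finset.sum_congr rfl fun l _ => ?_
  rw [Complex.star_def, Complex.mul_conj, Complex.ofReal_re, Complex.normSq_eq_norm_sq]

/-! ### Toeplitz forms: perturbation and periodization. -/

/-- The Schur test for Toeplitz forms. -/
theorem norm_toeplitzForm_le {ι : Type*} [Fintype ι] {pos : ι → ℤ} (hpos : Function.Injective pos)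
    {b : ℤ → ℂ} {η : ℝ} (hb : ∀ t : Finset ℤ, ∑ k ∈ t, ‖b k‖ ≤ η) (x : ι → ℂ) :
    ‖toeplitzForm pos b x‖ ≤ η * ∑ i, ‖x i‖ ^ 2 := by
  classical
  have hrow : ∀ i, ∑ j, ‖b (pos i - pos j)‖ ≤ η := fun i => by
    have hinj : Function.Injective fun j => pos i - pos j := fun j k h => hpos (by simpa using h)
    simpa [Finset.sum_image hinj.injOn] using hb (Finset.univ.image fun j => pos i - pos j)
  have hcol : ∀ j, ∑ i, ‖b (pos i - pos j)‖ ≤ η := fun j => by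
    have hinj : Function.Injective fun i => pos i - pos j := fun i k h => hpos (by simpa using h)
    simpa [Finset.sum_image hinj.injOn] using hb (Finset.univ.image fun i => pos i - pos j)
  have h1 : ‖toeplitzForm pos b x‖ ≤
      ∑ i, ∑ j, (‖b (pos i - pos j)‖ * ‖x i‖ ^ 2 / 2 + ‖b (pos i - pos j)‖ * ‖x j‖ ^ 2 / 2) := by
    refine (norm_sum_le _ _).trans (Finset.sum_le_sum fun i _ => (norm_sum_le _ _).trans
      (Finset.sum_le_sum fun j _ => ?_))
    rw [norm_mul, norm_mul, norm_star]
    -- AM-GM splits the form into row sums and column sums, each at most `η`.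
    nlinarith [mul_nonneg (norm_nonneg (b (pos i - pos j))) (sq_nonneg (‖x i‖ - ‖x j‖))]
  have h2 : ∑ i, ∑ j, ‖b (pos i - pos j)‖ * ‖x i‖ ^ 2 / 2 ≤ ∑ i, η * ‖x i‖ ^ 2 / 2 :=
    Finset.sum_le_sum fun i _ => by
      rw [← Finset.sum_div, ← Finset.sum_mul]
      gcongr
      exact hrow i
  have h3 : ∑ i, ∑ j, ‖b (pos i - pos j)‖ * ‖x j‖ ^ 2 / 2 ≤ ∑ j, η * ‖x j‖ ^ 2 / 2 := by
    rw [Finset.sum_comm]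
    refine Finset.sum_le_sum fun j _ => ?_
    rw [← Finset.sum_div, ← Finset.sum_mul]
    gcongr
    exact hcol j
  simp only [Finset.sum_add_distrib] at h1
  rw [← Finset.sum_div, ← Finset.mul_sum] at h2 h3
  linarith

theorem toeplitzForm_add {ι : Type*} [Fintype ι] (pos : ι → ℤ) (a b : ℤ → ℂ) (x : ι → ℂ) :
    toeplitzForm pos (a + b) x = toeplitzForm pos a x + toeplitzForm pos b x := by
  simp only [toeplitzForm, Pi.add_apply, mul_add, add_mul, Finset.sum_add_distrib]

/-- Only the main diagonal and its two neighbours contribute, with `L + 1`, `L` and `L` entries. -/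
theorem sum_range_sum_range_banded {F : ℤ → ℂ} (hF : ∀ d, 2 ≤ |d| → F d = 0) (L : ℕ) :
    ∑ p ∈ Finset.range (L + 1), ∑ q ∈ Finset.range (L + 1), F ((p : ℤ) - q) =
      (L + 1) * F 0 + L * (F 1 + F (-1)) := by
  induction L with
  | zero => simp
  | succ L ih =>
    have h1 : ∑ q ∈ Finset.range (L + 1), F (((L + 1 : ℕ) : ℤ) - q) = F 1 := by
      rw [Finset.sum_range_succ, Finset.sum_eq_zero, zero_add]
      · congr 1; push_cast; ring
      · intro q hq
        have := Finset.mem_range.1 hq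
        exact hF _ (le_abs.2 (Or.inl (by push_cast; omega)))
    have h2 : ∑ p ∈ Finset.range (L + 1), F ((p : ℤ) - (L + 1 : ℕ)) = F (-1) := by
      rw [Finset.sum_range_succ, Finset.sum_eq_zero, zero_add]
      · congr 1; push_cast; ring
      · intro q hq
        have := Finset.mem_range.1 hq
        exact hF _ (le_abs.2 (Or.inr (by push_cast; omega)))
    rw [Finset.sum_range_succ, Finset.sum_range_succ (fun q : ℕ => F (((L + 1 : ℕ) : ℤ) - q)), h1,
      Finset.sum_congr rfl fun p (_ : p ∈ Finset.range (L + 1)) =>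
        Finset.sum_range_succ (fun q : ℕ => F ((p : ℤ) - q)) (L + 1),
      Finset.sum_add_distrib, ih, h2, sub_self]
    push_cast
    ring

/-- A coercive banded Toeplitz form remains coercive after periodization. -/
theorem le_periodized_toeplitzForm {ι : Type} [Fintype ι] {q : ι → ℕ} {m : ℕ}
    (hq : Function.Injective q) (hqm : ∀ i, q i < m) {a : ℤ → ℂ} {δ : ℝ}
    (ha : ∀ d : ℤ, 2 ≤ |d| → ∀ i j, a (m * d + (q i - q j)) = 0)
    (hle : ∀ (κ : Type) [Fintype κ] (r : κ → ℕ), Function.Injective r → ∀ x : κ → ℂ,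
        δ * ∑ i, ‖x i‖ ^ 2 ≤ (toeplitzForm (fun i => (r i : ℤ)) a x).re) (x : ι → ℂ) :
    δ * ∑ i, ‖x i‖ ^ 2 ≤ (∑ i, ∑ j, star (x i) *
      (a (q i - q j) + a (m + (q i - q j)) + a (-m + (q i - q j))) * x j).re := by
  -- `F d` is the interaction between two copies of `x` whose positions differ by `d` periods.
  set F : ℤ → ℂ := fun d => ∑ i, ∑ j, star (x i) * a (m * d + (q i - q j)) * x j with hFdef
  have hF : ∀ d, 2 ≤ |d| → F d = 0 := fun d hd => by simp [hFdef, ha d hd]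
  have hsum : ∑ i, ∑ j, star (x i) *
      (a (q i - q j) + a (m + (q i - q j)) + a (-m + (q i - q j))) * x j = F 0 + F 1 + F (-1) := by
    simp [hFdef, mul_add, add_mul, Finset.sum_add_distrib]
  have key : ∀ L : ℕ, ((L : ℝ) + 1) * (δ * ∑ i, ‖x i‖ ^ 2) ≤
      (L + 1) * (F 0).re + L * ((F 1).re + (F (-1)).re) := by
    intro L
    -- `L + 1` copies of `x` are placed in consecutive blocks of length `m`; quotient and remainder
    -- by `m` recover block and index.
    have hinj : Function.Injective fun s : Fin (L + 1) × ι => m * (s.1 : ℕ) + q s.2 := by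
      rintro ⟨p, i⟩ ⟨p', j⟩ h
      simp only at h
      have hm : 0 < m := (Nat.zero_le _).trans_lt (hqm i)
      have h1 := congrArg (· / m) h
      have h2 := congrArg (· % m) h
      simp only [Nat.mul_add_div hm, Nat.div_eq_of_lt (hqm _), Nat.mul_add_mod,
        Nat.mod_eq_of_lt (hqm _), add_zero] at h1 h2
      exact Prod.ext (Fin.ext h1) (hq h2)
    have h := hle _ _ hinj fun s => x s.2
    have hform : toeplitzForm (fun s : Fin (L + 1) × ι => ((m * (s.1 : ℕ) + q s.2 : ℕ) : ℤ)) a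
        (fun s => x s.2) = (L + 1) * F 0 + L * (F 1 + F (-1)) := by
      rw [← sum_range_sum_range_banded hF]
      simp only [toeplitzForm, Fintype.sum_prod_type, Finset.sum_range, hFdef]
      refine Finset.sum_congr rfl fun p _ => ?_
      rw [Finset.sum_comm]
      refine Finset.sum_congr rfl fun p' _ => Finset.sum_congr rfl fun i _ =>
        Finset.sum_congr rfl fun j _ => ?_
      congr 3
      push_cast
      ring
    rw [hform] at h
    have hl : ∑ s : Fin (L + 1) × ι, ‖x s.2‖ ^ 2 = (L + 1) * ∑ i, ‖x i‖ ^ 2 := by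
      simp [Fintype.sum_prod_type]
    rw [hl] at h
    have hre : ((L + 1 : ℂ) * F 0 + L * (F 1 + F (-1))).re =
        (L + 1) * (F 0).re + L * ((F 1).re + (F (-1)).re) := by
      have : (L + 1 : ℂ) * F 0 + L * (F 1 + F (-1)) =
          ((L + 1 : ℝ) : ℂ) * F 0 + ((L : ℝ) : ℂ) * (F 1 + F (-1)) := by push_cast; ring
      rw [this, Complex.add_re, Complex.re_ofReal_mul, Complex.re_ofReal_mul, Complex.add_re]
    rw [hre] at h
    linarith
  rw [hsum, Complex.add_re, Complex.add_re]
  -- Dividing `key` by `L` and letting `L` grow gives the claim: the missing end interactions are a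
  -- bounded error.
  by_contra! hlt
  obtain ⟨L, hL⟩ := exists_nat_gt ((-((F 1).re + (F (-1)).re)) /
    (δ * ∑ i, ‖x i‖ ^ 2 - ((F 0).re + (F 1).re + (F (-1)).re)))
  rw [div_lt_iff₀ (by linarith)] at hL
  have := key L
  nlinarith

/-! ### The embedding matrix and the lower bound for its Schur complement. -/

theorem toeplitzSection_isHermitian {a : ℤ → ℂ} (ha : ∀ k, a (-k) = star (a k)) (n : ℕ) :
    (toeplitzSection a n).IsHermitian := by
  ext k l
  rw [Matrix.conjTranspose_apply, toeplitzSection, Matrix.of_apply, Matrix.of_apply, ← ha]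
  congr 1
  ring

theorem embeddingBlock_eq_add (a : ℤ → ℂ) (n : ℕ) (b₀ : ℂ) :
    embeddingBlock a n b₀ = embeddingBlock a n 0 + b₀ • 1 := by
  ext k l
  rcases lt_trichotomy k l with h | rfl | h
  · simp [embeddingBlock, h, h.ne]
  · simp [embeddingBlock]
  · simp [embeddingBlock, h.not_gt, h.ne']

theorem embeddingBlock_zero_isHermitian {a : ℤ → ℂ} (ha : ∀ k, a (-k) = star (a k)) (n : ℕ) :
    (embeddingBlock a n 0).IsHermitian := by
  ext k l
  rw [Matrix.conjTranspose_apply]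
  rcases lt_trichotomy k l with h | rfl | h
  · simp only [embeddingBlock, Matrix.of_apply, h, h.not_gt, h.ne', if_true, if_false]
    rw [← ha]
    congr 1
    ring
  · simp [embeddingBlock]
  · simp only [embeddingBlock, Matrix.of_apply, h, h.not_gt, h.ne', if_true, if_false]
    rw [← ha]
    congr 1
    ring

/-- The embedding matrix with zero corner entry is the periodization of the symbol truncated to
degrees below `n`. -/
theorem periodized_truncation_eq (a : ℤ → ℂ) (n : ℕ) (s t : Fin n ⊕ Fin n) :
    let a' : ℤ → ℂ := Set.indicator {k | |k| < (n : ℤ)} a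
    let q : Fin n ⊕ Fin n → ℕ := Sum.elim (fun k => (k : ℕ)) fun k => n + k
    a' (q s - q t) + a' ((2 * n : ℕ) + (q s - q t)) + a' (-(2 * n : ℕ) + (q s - q t)) =
      Matrix.fromBlocks (toeplitzSection a n) (embeddingBlock a n 0) (embeddingBlock a n 0)
        (toeplitzSection a n) s t := by
  intro a' q
  have hin : ∀ k : ℤ, |k| < n → a' k = a k := fun k hk => Set.indicator_of_mem (s := {k | |k| < (n : ℤ)}) hk a
  have hout : ∀ k : ℤ, n ≤ |k| → a' k = 0 := fun k hk =>
    Set.indicator_of_notMem (s := {k | |k| < (n : ℤ)}) (not_lt.2 hk) a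
  rcases s with k | k <;> rcases t with l | l <;> have hk := k.2 <;> have hl := l.2 <;>
    simp only [q, Sum.elim_inl, Sum.elim_inr, Matrix.fromBlocks_apply₁₁,
      Matrix.fromBlocks_apply₁₂, Matrix.fromBlocks_apply₂₁, Matrix.fromBlocks_apply₂₂,
      toeplitzSection, embeddingBlock, Matrix.of_apply]
  · rw [hin _ (abs_lt.2 (by omega)), hout _ (le_abs.2 (by omega)), hout _ (le_abs.2 (by omega))]
    simp
  · rcases lt_trichotomy k l with h | rfl | h
    · rw [if_pos h]
      rw [Fin.lt_def] at h
      rw [hout _ (le_abs.2 (by omega)), hin _ (abs_lt.2 (by omega)), hout _ (le_abs.2 (by omega))]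
      simp only [zero_add, add_zero]
      exact congrArg a (by omega)
    · rw [hout _ (le_abs.2 (by omega)), hout _ (le_abs.2 (by omega)), hout _ (le_abs.2 (by omega))]
      simp
    · rw [if_neg h.not_gt, if_neg h.ne']
      rw [Fin.lt_def] at h
      rw [hin _ (abs_lt.2 (by omega)), hout _ (le_abs.2 (by omega)), hout _ (le_abs.2 (by omega))]
      simp only [add_zero]
      exact congrArg a (by omega)
  · rcases lt_trichotomy k l with h | rfl | h
    · rw [if_pos h]
      rw [Fin.lt_def] at h
      rw [hin _ (abs_lt.2 (by omega)), hout _ (le_abs.2 (by omega)), hout _ (le_abs.2 (by omega))]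
      simp only [add_zero]
      exact congrArg a (by omega)
    · rw [hout _ (le_abs.2 (by omega)), hout _ (le_abs.2 (by omega)), hout _ (le_abs.2 (by omega))]
      simp
    · rw [if_neg h.not_gt, if_neg h.ne']
      rw [Fin.lt_def] at h
      rw [hout _ (le_abs.2 (by omega)), hout _ (le_abs.2 (by omega)), hin _ (abs_lt.2 (by omega))]
      simp only [zero_add]
      exact congrArg a (by omega)
  · rw [hin _ (abs_lt.2 (by omega)), hout _ (le_abs.2 (by omega)), hout _ (le_abs.2 (by omega))]
    simp

theorem star_dotProduct_mulVec_eq_sum {m : Type*} [Fintype m] (M : Matrix m m ℂ) (x : m → ℂ) :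
    star x ⬝ᵥ M *ᵥ x = ∑ i, ∑ j, star (x i) * M i j * x j := by
  simp [dotProduct, Matrix.mulVec, Finset.mul_sum, mul_assoc]

theorem Matrix.PosSemidef.of_re_nonneg {m : Type*} [Fintype m] {M : Matrix m m ℂ}
    (hM : M.IsHermitian) (h : ∀ x : m → ℂ, 0 ≤ (star x ⬝ᵥ M *ᵥ x).re) : M.PosSemidef :=
  .of_dotProduct_mulVec_nonneg hM fun x =>
    Complex.nonneg_iff.2 ⟨h x, (hM.im_star_dotProduct_mulVec_self x).symm⟩

theorem re_star_dotProduct_smul_one_mulVec {m : Type*} [Fintype m] [DecidableEq m] (δ : ℝ)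
    (x : m → ℂ) :
    (star x ⬝ᵥ ((δ : ℂ) • (1 : Matrix m m ℂ)) *ᵥ x).re = δ * ∑ i, ‖x i‖ ^ 2 := by
  rw [Matrix.smul_mulVec, Matrix.one_mulVec, dotProduct_smul, smul_eq_mul, Complex.re_ofReal_mul,
    dotProduct, Complex.re_sum]
  congr 1
  refine Finset.sum_congr rfl fun i _ => ?_
  rw [Pi.star_apply, Complex.star_def, Complex.conj_mul', ← Complex.ofReal_pow, Complex.ofReal_re]

theorem toeplitzSection_sub_posSemidef
    {a : ℤ → ℂ} {δ : ℝ} (ha : ∀ k, a (-k) = star (a k))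
    (hle : ∀ (ι : Type) [Fintype ι] (q : ι → ℕ), Function.Injective q → ∀ x : ι → ℂ,
          δ * ∑ i, ‖x i‖ ^ 2 ≤ (toeplitzForm (fun i => (q i : ℤ)) a x).re)
    (n : ℕ) :
    (toeplitzSection a n - (δ : ℂ) • 1).PosSemidef := by
  refine .of_re_nonneg ((toeplitzSection_isHermitian ha n).sub ?_) fun x => ?_
  · simp [Matrix.IsHermitian]
  · have h := hle (Fin n) (fun k => k) Fin.val_injective x
    rw [Matrix.sub_mulVec, dotProduct_sub, Complex.sub_re, re_star_dotProduct_smul_one_mulVec,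
      star_dotProduct_mulVec_eq_sum, sub_nonneg]
    exact h

theorem le_re_embedding_form
    {a : ℤ → ℂ} {δ : ℝ}
    (hle : ∀ (ι : Type) [Fintype ι] (q : ι → ℕ), Function.Injective q → ∀ x : ι → ℂ,
          δ * ∑ i, ‖x i‖ ^ 2 ≤ (toeplitzForm (fun i => (q i : ℤ)) a x).re)
    {n : ℕ} {η : ℝ}
    (htail : ∀ t : Finset ℤ, (∀ k ∈ t, (n : ℤ) ≤ |k|) → ∑ k ∈ t, ‖a k‖ ≤ η)
    (x : Fin n ⊕ Fin n → ℂ) :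
    (δ - η) * ∑ i, ‖x i‖ ^ 2 ≤ (star x ⬝ᵥ Matrix.fromBlocks (toeplitzSection a n)
      (embeddingBlock a n 0) (embeddingBlock a n 0) (toeplitzSection a n) *ᵥ x).re := by
  set I : Set ℤ := {k | |k| < (n : ℤ)} with hI
  have hb : ∀ t : Finset ℤ, ∑ k ∈ t, ‖Set.indicator Iᶜ a k‖ ≤ η := fun t => by
    classical
    have h1 : ∑ k ∈ t, ‖Set.indicator Iᶜ a k‖ = ∑ k ∈ t with k ∈ Iᶜ, ‖a k‖ := by
      rw [Finset.sum_filter]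
      refine Finset.sum_congr rfl fun k _ => ?_
      rw [Set.indicator_apply]
      split_ifs <;> simp
    rw [h1]
    refine htail _ fun k hk => ?_
    simpa [hI] using (Finset.mem_filter.1 hk).2
  have hle' : ∀ (κ : Type) [Fintype κ] (r : κ → ℕ), Function.Injective r → ∀ x : κ → ℂ,
      (δ - η) * ∑ i, ‖x i‖ ^ 2 ≤
        (toeplitzForm (fun i => (r i : ℤ)) (Set.indicator I a) x).re := by
    intro κ _ r hr x
    have h1 := hle κ r hr x
    have h2 := norm_toeplitzForm_le (pos := fun i => (r i : ℤ)) (Nat.cast_injective.comp hr) hb x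
    rw [← Set.indicator_self_add_compl I a, toeplitzForm_add, Complex.add_re] at h1
    have h3 := (Complex.re_le_norm _).trans h2
    linarith
  have hq : Function.Injective (Sum.elim (fun k => (k : ℕ)) fun k => n + k : Fin n ⊕ Fin n → ℕ) := by
    rintro (k | k) (l | l) h <;> simp only [Sum.elim_inl, Sum.elim_inr] at h <;>
      have hk := k.2 <;> have hl := l.2
    · exact congrArg _ (Fin.ext h)
    · omega
    · omega
    · exact congrArg _ (Fin.ext (by omega))
  have hqm : ∀ i, (Sum.elim (fun k => (k : ℕ)) fun k => n + k : Fin n ⊕ Fin n → ℕ) i < 2 * n := by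
    rintro (k | k) <;> have hk := k.2 <;> simp only [Sum.elim_inl, Sum.elim_inr] <;> omega
  have h := le_periodized_toeplitzForm hq hqm (a := Set.indicator I a) (fun d hd i j => ?_) hle' x
  · rw [star_dotProduct_mulVec_eq_sum]
    simpa only [hI, periodized_truncation_eq] using h
  -- Positions lie in `[0, 2n)`, so a shift by at least two periods leaves a difference of modulus
  -- at least `n`, outside the truncation.
  · refine Set.indicator_of_notMem (s := I) (fun h => not_le.2 (show |_| < (n : ℤ) from h) ?_) a
    have hi := hqm i
    have hj := hqm j
    generalize (Sum.elim (fun k => (k : ℕ)) fun k => n + k : Fin n ⊕ Fin n → ℕ) i = u at hi ⊢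
    generalize (Sum.elim (fun k => (k : ℕ)) fun k => n + k : Fin n ⊕ Fin n → ℕ) j = v at hj ⊢
    push_cast
    rcases le_abs.1 hd with hd | hd
    · refine le_abs.2 (Or.inl ?_)
      nlinarith
    · refine le_abs.2 (Or.inr ?_)
      nlinarith

/-- Lowering the second diagonal block by `δ/2` lowers the Schur complement by the same amount, so
positivity of the modified block matrix suffices. Truncation and the possibly nonreal corner entry
cost `η` each, and `2η ≤ δ/2` leaves room for the shift. -/
theorem embeddingPreconditioner_sub_posSemidef
    {a : ℤ → ℂ} {δ : ℝ} (ha : ∀ k, a (-k) = star (a k))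
    (hle : ∀ (ι : Type) [Fintype ι] (q : ι → ℕ), Function.Injective q → ∀ x : ι → ℂ,
          δ * ∑ i, ‖x i‖ ^ 2 ≤ (toeplitzForm (fun i => (q i : ℤ)) a x).re)
    (hδ : 0 < δ) {n : ℕ} {η : ℝ} (hη : 4 * η ≤ δ)
    (htail : ∀ t : Finset ℤ, (∀ k ∈ t, (n : ℤ) ≤ |k|) → ∑ k ∈ t, ‖a k‖ ≤ η)
    {b₀ : ℂ} (hb₀ : ‖b₀‖ ≤ η) :
    (embeddingPreconditioner a n b₀ - ((δ / 2 : ℝ) : ℂ) • 1).PosSemidef := by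
  have hA : (toeplitzSection a n).PosDef :=
    Matrix.PosDef.of_sub_smul_one hδ (toeplitzSection_sub_posSemidef ha hle n)
  have := hA.isUnit.invertible
  have hherm : ∀ r : ℝ, ((r : ℂ) • (1 : Matrix (Fin n) (Fin n) ℂ)).IsHermitian := fun r => by
    simp [Matrix.IsHermitian]
  have hC : (Matrix.fromBlocks (toeplitzSection a n) (embeddingBlock a n b₀)ᴴ
      (embeddingBlock a n b₀)ᴴᴴ (toeplitzSection a n - ((δ / 2 : ℝ) : ℂ) • 1)).PosSemidef := by
    refine .of_re_nonneg (.fromBlocks (toeplitzSection_isHermitian ha n) rfl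
      ((toeplitzSection_isHermitian ha n).sub (hherm _))) fun x => ?_
    have hsplit : Matrix.fromBlocks (toeplitzSection a n) (embeddingBlock a n b₀)ᴴ
        (embeddingBlock a n b₀)ᴴᴴ (toeplitzSection a n - ((δ / 2 : ℝ) : ℂ) • 1) =
        Matrix.fromBlocks (toeplitzSection a n) (embeddingBlock a n 0) (embeddingBlock a n 0)
          (toeplitzSection a n) +
        Matrix.fromBlocks 0 (star b₀ • 1) (b₀ • 1) (-(((δ / 2 : ℝ) : ℂ) • 1)) := by
      rw [Matrix.fromBlocks_add, embeddingBlock_eq_add a n b₀, Matrix.conjTranspose_conjTranspose,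
        Matrix.conjTranspose_add, (embeddingBlock_zero_isHermitian ha n).eq,
        Matrix.conjTranspose_smul, Matrix.conjTranspose_one, add_zero, sub_eq_add_neg]
    have h1 := le_re_embedding_form hle htail x
    have h2 : star x ⬝ᵥ Matrix.fromBlocks 0 (star b₀ • (1 : Matrix (Fin n) (Fin n) ℂ)) (b₀ • 1)
        (-(((δ / 2 : ℝ) : ℂ) • 1)) *ᵥ x =
        ∑ k, (star (x (.inl k)) * star b₀ * x (.inr k) + star (x (.inr k)) * b₀ * x (.inl k)
          - ((δ / 2 * ‖x (.inr k)‖ ^ 2 : ℝ) : ℂ)) := by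
      rw [Matrix.fromBlocks_mulVec, dotProduct, Fintype.sum_sum_type, ← Finset.sum_add_distrib]
      refine Finset.sum_congr rfl fun k _ => ?_
      have h3 := Complex.conj_mul' (x (.inr k))
      simp [Matrix.smul_mulVec, Matrix.neg_mulVec]
      linear_combination (-(δ : ℂ) / 2) * h3
    rw [hsplit, Matrix.add_mulVec, dotProduct_add, Complex.add_re, h2, Complex.re_sum]
    have h4 : ∀ k, -(η * (‖x (.inl k)‖ ^ 2 + ‖x (.inr k)‖ ^ 2)) - δ / 2 * ‖x (.inr k)‖ ^ 2 ≤
        (star (x (.inl k)) * star b₀ * x (.inr k) + star (x (.inr k)) * b₀ * x (.inl k)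
          - ((δ / 2 * ‖x (.inr k)‖ ^ 2 : ℝ) : ℂ)).re := fun k => by
      have h5 := (abs_le.1 (Complex.abs_re_le_norm (star (x (.inl k)) * star b₀ * x (.inr k)))).1
      have h6 := (abs_le.1 (Complex.abs_re_le_norm (star (x (.inr k)) * b₀ * x (.inl k)))).1
      rw [norm_mul, norm_mul, norm_star, norm_star] at h5
      rw [norm_mul, norm_mul, norm_star] at h6
      rw [Complex.sub_re, Complex.add_re, Complex.ofReal_re]
      have h7 : ‖b₀‖ * (2 * (‖x (.inl k)‖ * ‖x (.inr k)‖)) ≤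
          η * (‖x (.inl k)‖ ^ 2 + ‖x (.inr k)‖ ^ 2) :=
        mul_le_mul hb₀ (by nlinarith [sq_nonneg (‖x (.inl k)‖ - ‖x (.inr k)‖)]) (by positivity)
          ((norm_nonneg _).trans hb₀)
      linarith
    have h8 := Finset.sum_le_sum fun k (_ : k ∈ Finset.univ) => h4 k
    rw [Finset.sum_sub_distrib, Finset.sum_neg_distrib, ← Finset.mul_sum, ← Finset.mul_sum,
      Finset.sum_add_distrib] at h8
    rw [Fintype.sum_sum_type] at h1
    have h9 : 0 ≤ ∑ k, ‖x (.inl k)‖ ^ 2 := by positivity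
    have h10 : 0 ≤ ∑ k, ‖x (.inr k)‖ ^ 2 := by positivity
    nlinarith
  have h := (Matrix.PosDef.fromBlocks₁₁ _ _ hA).1 hC
  rw [Matrix.conjTranspose_conjTranspose] at h
  rwa [embeddingPreconditioner, sub_right_comm]

/-! ### Consequences of exponential decay. -/

theorem sum_pow_sub_le {q : ℝ} (h0 : 0 ≤ q) (h1 : q < 1) (n : ℕ) :
    ∑ k : Fin n, q ^ (k : ℕ) ≤ (1 - q)⁻¹ ∧ ∑ k : Fin n, q ^ (n - (k : ℕ)) ≤ (1 - q)⁻¹ := by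
  have h2 : ∀ m, ∑ k ∈ Finset.range m, q ^ k ≤ (1 - q)⁻¹ := fun m =>
    (tsum_geometric_of_lt_one h0 h1) ▸
      (summable_geometric_of_lt_one h0 h1).sum_le_tsum _ fun _ _ => pow_nonneg h0 _
  refine ⟨by simpa [Finset.sum_range] using h2 n, ?_⟩
  rw [← Finset.sum_range (fun k => q ^ (n - k))]
  -- The exponents `n - k` run over `1, …, n`, so adding the exponent `0` gives a geometric sum of
  -- `n + 1` terms.
  refine le_trans ?_ (h2 (n + 1))
  rw [Finset.sum_range_succ', ← Finset.sum_range_reflect]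
  refine le_trans (Finset.sum_le_sum fun k hk => ?_) (le_add_of_nonneg_right (by simp))
  have hk' := Finset.mem_range.1 hk
  rw [show n - (n - 1 - k) = k + 1 by omega]

/-- The Frobenius norm of the embedding block is bounded independently of its size. -/
theorem sum_norm_sq_embeddingBlock_le {a : ℤ → ℂ} {c ρ : ℝ} (h0 : 0 ≤ ρ) (h1 : ρ < 1)
    (ha : ∀ k : ℤ, ‖a k‖ ≤ c * ρ ^ k.natAbs) {n : ℕ} {b₀ : ℂ} (hb₀ : b₀ = a n ∨ b₀ = 0) :
    ∑ k, ∑ l, ‖embeddingBlock a n b₀ k l‖ ^ 2 ≤ 2 * c ^ 2 * ((1 - ρ ^ 2)⁻¹) ^ 2 := by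
  have hc : 0 ≤ c := by simpa using (norm_nonneg _).trans (ha 0)
  -- Each term dominates one triangle and separates `k` from `l`, so the double sum factors into
  -- geometric sums. The diagonal fits the first term, since `k + (n - k) = n` and `‖b₀‖ ≤ c * ρ ^
  -- n`.
  have hentry : ∀ k l : Fin n, ‖embeddingBlock a n b₀ k l‖ ^ 2 ≤
      c ^ 2 * ((ρ ^ 2) ^ (k : ℕ) * (ρ ^ 2) ^ (n - (l : ℕ))) +
      c ^ 2 * ((ρ ^ 2) ^ (n - (k : ℕ)) * (ρ ^ 2) ^ (l : ℕ)) := by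
    intro k l
    have hk := k.2
    have hl := l.2
    have hsq : ∀ {z : ℂ} {m : ℕ}, ‖z‖ ≤ c * ρ ^ m → ‖z‖ ^ 2 ≤ c ^ 2 * (ρ ^ 2) ^ m := fun h => by
      rw [← pow_mul, mul_comm 2, pow_mul, ← mul_pow]
      exact pow_le_pow_left₀ (norm_nonneg _) h 2
    rw [← pow_add, ← pow_add]
    rcases lt_trichotomy k l with h | rfl | h
    · simp only [embeddingBlock, Matrix.of_apply, h, if_true]
      have h2 := hsq (ha ((n : ℤ) + k - l))
      rw [Fin.lt_def] at h
      rw [show ((n : ℤ) + k - l).natAbs = (k : ℕ) + (n - l) by omega] at h2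
      exact h2.trans (le_add_of_nonneg_right (by positivity))
    · simp only [embeddingBlock, Matrix.of_apply, lt_irrefl, if_true, if_false]
      have h2 : ‖b₀‖ ≤ c * ρ ^ n := by
        rcases hb₀ with rfl | rfl
        · simpa using ha n
        · simpa using by positivity
      have h3 := hsq h2
      rw [show (k : ℕ) + (n - k) = n by omega]
      exact h3.trans (le_add_of_nonneg_right (by positivity))
    · simp only [embeddingBlock, Matrix.of_apply, h.not_gt, h.ne', if_false]
      have h2 := hsq (ha ((k : ℤ) - l - n))
      rw [Fin.lt_def] at h
      rw [show ((k : ℤ) - l - n).natAbs = (n - (k : ℕ)) + l by omega] at h2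
      exact h2.trans (le_add_of_nonneg_left (by positivity))
  have hq : ρ ^ 2 < 1 := pow_lt_one₀ h0 h1 two_ne_zero
  obtain ⟨h2, h3⟩ := sum_pow_sub_le (sq_nonneg ρ) hq n
  have h4 : 0 ≤ (1 - ρ ^ 2)⁻¹ := inv_nonneg.2 (sub_nonneg.2 hq.le)
  refine (Finset.sum_le_sum fun k _ => Finset.sum_le_sum fun l _ => hentry k l).trans ?_
  simp only [Finset.sum_add_distrib, ← Finset.mul_sum, ← Finset.sum_mul]
  have h5 := mul_le_mul h2 h3 (by positivity) h4
  have h6 := mul_le_mul h3 h2 (by positivity) h4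
  nlinarith [sq_nonneg c]

theorem exists_tail_sum_norm_le {a : ℤ → ℂ} (ha : Summable fun k => ‖a k‖) {η : ℝ} (hη : 0 < η) :
    ∃ M : ℕ, 0 < M ∧ ∀ n : ℕ, M < n → ∀ t : Finset ℤ, (∀ k ∈ t, (n : ℤ) ≤ |k|) →
      ∑ k ∈ t, ‖a k‖ ≤ η := by
  obtain ⟨s, hs⟩ := summable_iff_vanishing_norm.1 ha η hη
  refine ⟨s.sup Int.natAbs + 1, Nat.succ_pos _, fun n hn t ht => ?_⟩
  refine (le_abs_self _).trans (hs t (Finset.disjoint_left.2 fun k hk hks => ?_)).le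
  have h1 := ht k hk
  rw [Int.abs_eq_natAbs] at h1
  have h2 := Finset.le_sup (f := Int.natAbs) hks
  omega

theorem summable_norm_of_le_geometric {a : ℤ → ℂ} {c ρ : ℝ} (h0 : 0 ≤ ρ) (h1 : ρ < 1)
    (ha : ∀ k : ℤ, ‖a k‖ ≤ c * ρ ^ k.natAbs) : Summable fun k => ‖a k‖ := by
  have hg := (summable_geometric_of_lt_one h0 h1).mul_left c
  refine Summable.of_nat_of_neg (hg.of_nonneg_of_le (fun _ => norm_nonneg _) fun n => ?_)
    (hg.of_nonneg_of_le (fun _ => norm_nonneg _) fun n => ?_)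
  · simpa using ha n
  · simpa using ha (-n)

/-! ### Assembly of the estimates. -/

theorem mainTheorem7 (a : ℤ → ℂ) (c γ : ℝ) (hγ : 0 < γ)
    (hdecay : ∀ k : ℤ, ‖a k‖ ≤ c * Real.exp (-γ * |(k : ℝ)|))
    (hpd : IsHPDToeplitz (fun k : ℤ => k) a ∨ IsHPDToeplitz (fun k : ℕ => (k : ℤ)) a) :
    ∀ ε : ℝ, 0 < ε → ∃ N M : ℕ, 0 < M ∧ ∀ n : ℕ, M < n →
      ∀ b₀ : ℂ, (b₀ = a n ∨ b₀ = 0) →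
        IsUnit (toeplitzSection a n) ∧
        IsUnit (embeddingPreconditioner a n b₀) ∧
        numEigenvaluesOutside
          ((embeddingPreconditioner a n b₀)⁻¹ * toeplitzSection a n - 1) 0 ε ≤ N ∧
        numEigenvaluesOutside
          ((embeddingPreconditioner a n b₀)⁻¹ * toeplitzSection a n) 1 ε ≤ N := by
  intro ε hε
  obtain ⟨hherm, δ, hδ, hle⟩ := IsHPDToeplitz.exists_coercive hpd
  set ρ := Real.exp (-γ) with hρ
  have hρ0 : 0 ≤ ρ := (Real.exp_pos _).le
  have hρ1 : ρ < 1 := by simpa [hρ] using hγ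
  have hgeo : ∀ k : ℤ, ‖a k‖ ≤ c * ρ ^ k.natAbs := fun k => by
    have h := hdecay k
    rwa [mul_comm (-γ), ← Int.cast_abs, Int.abs_eq_natAbs, Int.cast_natCast,
      Real.exp_nat_mul] at h
  obtain ⟨M, hM, htail⟩ := exists_tail_sum_norm_le (summable_norm_of_le_geometric hρ0 hρ1 hgeo)
    (η := δ / 4) (by positivity)
  -- The factors come from `S ≥ δ/2`, `A ≥ δ` and the Frobenius bound for `B`; none depends on `n`
  -- or `b₀`.
  set K := (δ / 2)⁻¹ * (δ⁻¹ * (2 * c ^ 2 * ((1 - ρ ^ 2)⁻¹) ^ 2)) with hK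
  refine ⟨⌊K / ε⌋₊, M, hM, fun n hn b₀ hb₀ => ?_⟩
  have hbn : ‖b₀‖ ≤ δ / 4 := by
    rcases hb₀ with rfl | rfl
    · simpa using htail n hn {(n : ℤ)} (by simp)
    · simpa using by positivity
  have hA' := toeplitzSection_sub_posSemidef hherm hle n
  have hS' := embeddingPreconditioner_sub_posSemidef hherm hle hδ (by linarith)
    (htail n hn) hbn
  have hA := Matrix.PosDef.of_sub_smul_one hδ hA'
  have hS := Matrix.PosDef.of_sub_smul_one (half_pos hδ) hS'
  set A := toeplitzSection a n with hAdef
  set S := embeddingPreconditioner a n b₀ with hSdef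
  set B := embeddingBlock a n b₀ with hBdef
  have hE : (B * A⁻¹ * Bᴴ).PosSemidef := hA.inv.posSemidef.mul_mul_conjTranspose_same B
  have htrace : (S⁻¹ * (B * A⁻¹ * Bᴴ)).trace.re ≤ K := by
    refine (Matrix.PosSemidef.trace_inv_mul_le (half_pos hδ) hS' hE).trans
      (mul_le_mul_of_nonneg_left ?_ (by positivity))
    have h1 := Matrix.PosSemidef.trace_inv_mul_le hδ hA' (Matrix.posSemidef_conjTranspose_mul_self B)
    -- Cyclicity turns the trace of `A⁻¹ Bᴴ B` into that of `B A⁻¹ Bᴴ`, and the trace of `Bᴴ B` into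
    -- the squared Frobenius norm.
    rw [← Matrix.mul_assoc, Matrix.trace_mul_comm, ← Matrix.mul_assoc, Matrix.trace_mul_comm Bᴴ,
      Matrix.trace_mul_conjTranspose_self_re] at h1
    exact h1.trans (mul_le_mul_of_nonneg_left
      (sum_norm_sq_embeddingBlock_le hρ0 hρ1 hgeo hb₀) (by positivity))
  have hX : S⁻¹ * A - 1 = S⁻¹ * (B * A⁻¹ * Bᴴ) := by
    have h1 : B * A⁻¹ * Bᴴ = A - S := by
      rw [hSdef, embeddingPreconditioner]
      abel
    rw [h1, Matrix.mul_sub, Matrix.nonsing_inv_mul _ ((Matrix.isUnit_iff_isUnit_det _).1 hS.isUnit)]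
  refine ⟨hA.isUnit, hS.isUnit, ?_, ?_⟩ <;> refine Nat.le_floor ((le_div_iff₀ hε).2 ?_)
  · exact (numEigenvaluesOutside_mul_le_trace hS hE (by simpa using hX) ε).trans htrace
  · exact (numEigenvaluesOutside_mul_le_trace hS hE (by simpa using hX) ε).trans htrace
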